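/- Conventions. Let $\tau$ be a relational signature, i.e. a set of relation symbols of finite arities. All structures are relational structures over $\tau$ and are countable, i.e. finite or countably infinite. For a structure $A$ and a subset $S$ of its domain, the \emph{orbit} of $S$ is $\{\alpha(S) \mid \alpha \in \mathrm{Aut}(A)\}$; if $|S| = n$, it is called an \emph{orbit of $n$-subsets} of $A$. The structure $A$ is \emph{$\omega$-categorical} if for every $n \in \mathbb{N}$ it has only finitely many orbits of $n$-subsets (finite structures are included). It is a \emph{core} if every endomorphism of $A$ is an embedding (i.e. an isomorphism onto an induced substructure), and \emph{model-complete} if every embedding of $A$ into itself preserves all first-order formulas. A \emph{model-complete core of $\Delta$} is a structure $\Gamma$ that is a core, is model-complete, and is homomorphically equivalent to $\Delta$, that is, there are homomorphisms $\Gamma \to \Delta$ and $\Delta \to \Gamma$. Proposition. Let $\Delta$ be an $\omega$-categorical structure and let $\Gamma$ be a model-complete core of $\Delta$. Then for every $n \in \mathbb{N}$, the number of orbits of $n$-subsets of $\Gamma$ is at most the number of orbits of $n$-subsets of $\Delta$. -/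

import Mathlib

open FirstOrder

universe u v w

/-- The orbit of a subset `S` of the domain under the automorphism group of the structure:
the set of all images `{α s | s ∈ S}`, where `α` ranges over the automorphisms. -/
def subsetOrbit (L : FirstOrder.Language.{u, v}) (M : Type w) [L.Structure M] (S : Set M) :
    Set (Set M) :=
  {T | ∃ α : M ≃[L] M, T = (fun x => α x) '' S}

/-- The set of all orbits of `n`-subsets of the structure `M`, i.e. of the orbits of those
subsets that have exactly `n` elements. -/
def nSubsetOrbits (L : FirstOrder.Language.{u, v}) (M : Type w) [L.Structure M] (n : ℕ) :
    Set (Set (Set M)) :=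
  {O | ∃ S : Set M, S.encard = (n : ℕ∞) ∧ O = subsetOrbit L M S}

/-- A structure is `ω`-categorical if it is countable (finite structures are allowed) and has,
for every `n`, only finitely many orbits of `n`-subsets. -/
def IsOmegaCategorical (L : FirstOrder.Language.{u, v}) (M : Type w) [L.Structure M] : Prop :=
  Countable M ∧ ∀ n : ℕ, (nSubsetOrbits L M n).Finite

/-- A structure is a core if each of its endomorphisms is an embedding. -/
def IsCoreStructure (L : FirstOrder.Language.{u, v}) (M : Type w) [L.Structure M] : Prop :=
  ∀ f : M →[L] M, ∃ e : M ↪[L] M, ∀ x : M, e x = f x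

/-- A structure is model-complete if each of its self-embeddings preserves all first-order
formulas. -/
def IsModelCompleteStructure (L : FirstOrder.Language.{u, v}) (M : Type w) [L.Structure M] :
    Prop :=
  ∀ (e : M ↪[L] M) (n : ℕ) (φ : L.Formula (Fin n)) (x : Fin n → M),
    φ.Realize x → φ.Realize (fun i => e (x i))

/-- Two structures are homomorphically equivalent if there are homomorphisms in both
directions. -/
def HomEquivalent (L : FirstOrder.Language.{u, v}) (M : Type w) (N : Type*) [L.Structure M]
    [L.Structure N] : Prop :=
  Nonempty (M →[L] N) ∧ Nonempty (N →[L] M)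

/-- `Γ` is a model-complete core of `Δ`: a countable (possibly finite) model-complete core
that is homomorphically equivalent to `Δ`. -/
structure IsModelCompleteCoreOf (L : FirstOrder.Language.{u, v}) (Γ : Type w) (Δ : Type*)
    [L.Structure Γ] [L.Structure Δ] : Prop where
  countable : Countable Γ
  isCore : IsCoreStructure L Γ
  isModelComplete : IsModelCompleteStructure L Γ
  homEquivalent : HomEquivalent L Γ Δ

/-! Fix homomorphisms `g : Γ → Δ` and `h : Δ → Γ`. Endomorphisms of `Γ` preserve types, so if an
automorphism `α` of `Δ` takes `g a` to `g b`, comparing `h ∘ α ∘ g` with `h ∘ g` shows that `a` and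
`b` have the same type (`tupleType_eq_of_conjugate_image`). Hence `Γ` realizes finitely many types
of each length, and back-and-forth makes tuples of equal type conjugate
(`exists_automorphism_of_tupleType_eq`). As `g` is injective, taking images under `g` separates
orbits of `n`-subsets. -/

open FirstOrder.Language

section Types

variable {L : FirstOrder.Language.{u, v}} {M : Type w} [L.Structure M]

/-- The complete type of a tuple, as the set of formulas that it satisfies. -/
def tupleType (L : FirstOrder.Language.{u, v}) {M : Type w} [L.Structure M] {ι : Type}
    (a : ι → M) : Set (L.Formula ι) :=
  {φ | φ.Realize a}

theorem tupleType_comp {ι κ : Type} {a b : ι → M} (h : tupleType L a = tupleType L b)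
    (f : κ → ι) : tupleType L (a ∘ f) = tupleType L (b ∘ f) := by
  ext φ
  have := Set.ext_iff.1 h (φ.relabel f)
  simpa only [tupleType, Set.mem_ofPred_eq, Formula.realize_relabel] using this

theorem tupleType_eq_of_subset {ι : Type} {a b : ι → M}
    (h : tupleType L a ⊆ tupleType L b) : tupleType L a = tupleType L b := by
  refine h.antisymm fun φ hb => ?_
  by_contra ha
  exact h (show φ.not ∈ tupleType L a from ha) hb

/-- If only finitely many types are realized, then each of them is isolated among them. -/
theorem exists_isolating_formula {ι : Type}
    (hfin : (Set.range (tupleType L : (ι → M) → _)).Finite) (a : ι → M) :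
    ∃ φ : L.Formula ι, φ.Realize a ∧
      ∀ b : ι → M, φ.Realize b → tupleType L a = tupleType L b := by
  have hsep : ∀ t : Set.range (tupleType L : (ι → M) → _), ∃ ψ : L.Formula ι,
      ψ.Realize a ∧ (ψ ∈ t.1 → tupleType L a = t.1) := by
    rintro ⟨_, b, rfl⟩
    by_cases h : tupleType L a ⊆ tupleType L b
    · exact ⟨⊤, Formula.realize_top.2 trivial, fun _ => tupleType_eq_of_subset h⟩
    · obtain ⟨ψ, ha, hb⟩ := Set.not_subset.1 h
      exact ⟨ψ, ha, fun h' => absurd h' hb⟩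
  choose ψ hψ hψ' using hsep
  have := hfin.to_subtype
  refine ⟨Formula.iInf ψ, Formula.realize_iInf.2 hψ, fun b hb => ?_⟩
  exact hψ' ⟨_, b, rfl⟩ (Formula.realize_iInf.1 hb _)

/-- If `φ` isolates the type of `(a, c)`, then `∃ y, φ` passes from `a` to `b`, and any witness
serves as `d`. -/
theorem exists_extension_of_tupleType_eq {ι : Type}
    (hfin : (Set.range (tupleType L : (ι ⊕ Unit → M) → _)).Finite)
    {a b : ι → M} (h : tupleType L a = tupleType L b) (c : M) :
    ∃ d : M, tupleType L (Sum.elim a fun _ : Unit => c) =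
      tupleType L (Sum.elim b fun _ : Unit => d) := by
  obtain ⟨φ, hφ, hiso⟩ := exists_isolating_formula hfin (Sum.elim a fun _ : Unit => c)
  have ha : φ.iExs Unit ∈ tupleType L a := Formula.realize_iExs.2 ⟨_, hφ⟩
  rw [h] at ha
  obtain ⟨d, hd⟩ := Formula.realize_iExs.1 ha
  exact ⟨d (), hiso _ hd⟩

/-- A relation is elementary if tuples that are related pointwise have the same type. -/
def IsElementaryRel (L : FirstOrder.Language.{u, v}) {M : Type w} [L.Structure M]
    (s : Set (M × M)) : Prop :=
  ∀ (k : ℕ) (x : Fin k → M × M), (∀ i, x i ∈ s) →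
    tupleType L (fun i => (x i).1) = tupleType L (fun i => (x i).2)

theorem isElementaryRel_range {ι : Type} {a b : ι → M}
    (h : tupleType L a = tupleType L b) :
    IsElementaryRel L (Set.range fun i => (a i, b i)) := by
  intro k x hx
  choose f hf using hx
  simp only [← hf]
  exact tupleType_comp h f

theorem IsElementaryRel.swap {s : Set (M × M)} (h : IsElementaryRel L s) :
    IsElementaryRel L (Prod.swap ⁻¹' s) :=
  fun k x hx => (h k (fun i => (x i).swap) hx).symm

theorem IsElementaryRel.iUnion {s : ℕ → Set (M × M)} (hs : Monotone s)
    (h : ∀ n, IsElementaryRel L (s n)) : IsElementaryRel L (⋃ n, s n) := by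
  intro k x hx
  choose m hm using fun i => Set.mem_iUnion.1 (hx i)
  exact h (Finset.univ.sup m) k x fun i => hs (Finset.le_sup (Finset.mem_univ i)) (hm i)

/-- Applied to the formula `x₀ = x₁`; this makes a total elementary relation the graph of a
bijection. -/
theorem IsElementaryRel.eq_iff {s : Set (M × M)} (h : IsElementaryRel L s) {p q : M × M}
    (hp : p ∈ s) (hq : q ∈ s) : p.1 = q.1 ↔ p.2 = q.2 := by
  have := Set.ext_iff.1 (h 2 ![p, q] (by simp [Fin.forall_fin_two, hp, hq]))
    ((Term.var 0).equal (Term.var 1))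
  simpa [tupleType] using this

theorem IsElementaryRel.relMap_iff {s : Set (M × M)} (h : IsElementaryRel L s) {k : ℕ}
    (r : L.Relations k) {x : Fin k → M × M} (hx : ∀ i, x i ∈ s) :
    Structure.RelMap r (fun i => (x i).1) ↔ Structure.RelMap r (fun i => (x i).2) := by
  have := Set.ext_iff.1 (h k x hx) (r.formula fun i => Term.var i)
  simpa [tupleType, Formula.realize_rel] using this

theorem IsElementaryRel.exists_extension_left
    (hfin : ∀ (ι : Type) [Finite ι], (Set.range (tupleType L : (ι → M) → _)).Finite)
    {s : Set (M × M)} (h : IsElementaryRel L s) (hs : s.Finite) (c : M) :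
    ∃ t, s ⊆ t ∧ IsElementaryRel L t ∧ t.Finite ∧ ∃ d, (c, d) ∈ t := by
  obtain ⟨k, x, -, rfl⟩ := hs.fin_param
  obtain ⟨d, hd⟩ := exists_extension_of_tupleType_eq (hfin _) (h k x fun i => ⟨i, rfl⟩) c
  refine ⟨_, ?_, isElementaryRel_range hd, Set.finite_range _, d, Sum.inr (), rfl⟩
  rintro _ ⟨i, rfl⟩
  exact ⟨Sum.inl i, rfl⟩

theorem IsElementaryRel.exists_extension
    (hfin : ∀ (ι : Type) [Finite ι], (Set.range (tupleType L : (ι → M) → _)).Finite)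
    {s : Set (M × M)} (h : IsElementaryRel L s) (hs : s.Finite) (c : M) :
    ∃ t, s ⊆ t ∧ IsElementaryRel L t ∧ t.Finite ∧ (∃ d, (c, d) ∈ t) ∧ ∃ d, (d, c) ∈ t := by
  obtain ⟨t, hst, ht, htf, d, hd⟩ := h.exists_extension_left hfin hs c
  obtain ⟨t', htt', ht', htf', d', hd'⟩ := ht.swap.exists_extension_left hfin
    (htf.preimage Prod.swap_injective.injOn) c
  refine ⟨Prod.swap ⁻¹' t', fun p hp => htt' ?_, ht'.swap,
    htf'.preimage Prod.swap_injective.injOn, ⟨d, htt' ?_⟩, d', hd'⟩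
  · simpa using hst hp
  · simpa using hd

/-- Back-and-forth: a finite elementary relation extends to one that is total on both sides. -/
theorem IsElementaryRel.exists_total_extension [Countable M]
    (hfin : ∀ (ι : Type) [Finite ι], (Set.range (tupleType L : (ι → M) → _)).Finite)
    {s : Set (M × M)} (h : IsElementaryRel L s) (hs : s.Finite) :
    ∃ t, s ⊆ t ∧ IsElementaryRel L t ∧ ∀ c, (∃ d, (c, d) ∈ t) ∧ ∃ d, (d, c) ∈ t := by
  cases isEmpty_or_nonempty M with
  | inl _ => exact ⟨s, subset_rfl, h, fun c => isEmptyElim c⟩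
  | inr _ =>
    obtain ⟨e, he⟩ := exists_surjective_nat M
    choose next hsub hel hf htot using
      fun (s : {s : Set (M × M) // IsElementaryRel L s ∧ s.Finite}) (c : M) =>
        s.2.1.exists_extension hfin s.2.2 c
    let S : ℕ → {s : Set (M × M) // IsElementaryRel L s ∧ s.Finite} := fun n =>
      Nat.rec ⟨s, h, hs⟩ (fun n s => ⟨next s (e n), hel s (e n), hf s (e n)⟩) n
    have hmono : Monotone fun n => (S n).1 := monotone_nat_of_le_succ fun n => hsub (S n) (e n)
    refine ⟨⋃ n, (S n).1, Set.subset_iUnion (fun n => (S n).1) 0,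
      .iUnion hmono fun n => (S n).2.1, fun c => ?_⟩
    obtain ⟨n, rfl⟩ := he c
    obtain ⟨⟨d, hd⟩, d', hd'⟩ := htot (S n) (e n)
    exact ⟨⟨d, Set.mem_iUnion.2 ⟨n + 1, hd⟩⟩, d', Set.mem_iUnion.2 ⟨n + 1, hd'⟩⟩

/-- In a countable structure that realizes only finitely many types of tuples of each length,
tuples of the same type are conjugate under the automorphism group. -/
theorem exists_automorphism_of_tupleType_eq [L.IsRelational] [Countable M]
    (hfin : ∀ (ι : Type) [Finite ι], (Set.range (tupleType L : (ι → M) → _)).Finite)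
    {ι : Type} [Finite ι] {a b : ι → M} (h : tupleType L a = tupleType L b) :
    ∃ α : M ≃[L] M, ∀ i, α (a i) = b i := by
  obtain ⟨t, hst, ht, htot⟩ :=
    (isElementaryRel_range h).exists_total_extension hfin (Set.finite_range _)
  choose f hf using fun c => (htot c).1
  choose g hg using fun c => (htot c).2
  refine ⟨{ toFun := f
            invFun := g
            left_inv := fun c => (ht.eq_iff (hg (f c)) (hf c)).2 rfl
            right_inv := fun c => (ht.eq_iff (hf (g c)) (hg c)).1 rfl
            map_fun' := fun r => isEmptyElim r
            map_rel' := fun r x => (ht.relMap_iff r fun i => hf (x i)).symm }, fun i => ?_⟩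
  exact (ht.eq_iff (hf (a i)) (hst ⟨i, rfl⟩)).1 rfl

end Types

section Orbits

variable {L : FirstOrder.Language.{u, v}} {M : Type w} [L.Structure M]

theorem mem_subsetOrbit_self (S : Set M) : S ∈ subsetOrbit L M S :=
  ⟨FirstOrder.Language.Equiv.refl L M, by simp⟩

theorem subsetOrbit_subset_of_mem {S T : Set M} (h : T ∈ subsetOrbit L M S) :
    subsetOrbit L M T ⊆ subsetOrbit L M S := by
  obtain ⟨α, rfl⟩ := h
  rintro _ ⟨β, rfl⟩
  exact ⟨β.comp α, by simp [Set.image_image]⟩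

theorem mem_subsetOrbit_symm {S T : Set M} (h : T ∈ subsetOrbit L M S) :
    S ∈ subsetOrbit L M T := by
  obtain ⟨α, rfl⟩ := h
  exact ⟨α.symm, by simp [Set.image_image]⟩

theorem subsetOrbit_eq_iff {S T : Set M} :
    subsetOrbit L M S = subsetOrbit L M T ↔ T ∈ subsetOrbit L M S :=
  ⟨fun h => h ▸ mem_subsetOrbit_self T, fun h =>
    (subsetOrbit_subset_of_mem (mem_subsetOrbit_symm h)).antisymm (subsetOrbit_subset_of_mem h)⟩

/-- In an `ω`-categorical structure some finite set meets every orbit of `ι`-tuples. -/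
theorem IsOmegaCategorical.exists_finite_set (h : IsOmegaCategorical L M)
    (ι : Type) [Finite ι] :
    ∃ F : Set M, F.Finite ∧ ∀ a : ι → M, ∃ α : M ≃[L] M, ∀ i, α (a i) ∈ F := by
  -- The range of an `ι`-tuple has at most `Nat.card ι` points, so the union of one representative
  -- per orbit up to that size will do.
  have hO : (⋃ n ≤ Nat.card ι, nSubsetOrbits L M n).Finite :=
    (Set.finite_Iic (Nat.card ι)).biUnion fun n _ => h.2 n
  have hrep : ∀ O ∈ ⋃ n ≤ Nat.card ι, nSubsetOrbits L M n,
      ∃ S : Set M, S.Finite ∧ O = subsetOrbit L M S := by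
    intro O hO
    obtain ⟨n, -, S, hS, rfl⟩ := Set.mem_iUnion₂.1 hO
    exact ⟨S, Set.finite_of_encard_eq_coe hS, rfl⟩
  choose! R hR hR' using hrep
  refine ⟨_, hO.biUnion hR, fun a => ?_⟩
  obtain ⟨n, hn⟩ := (Set.finite_range a).exists_encard_eq_coe
  have hmem : subsetOrbit L M (Set.range a) ∈ ⋃ n ≤ Nat.card ι, nSubsetOrbits L M n := by
    refine Set.mem_iUnion₂.2 ⟨n, ?_, _, hn, rfl⟩
    have : (n : ℕ∞) ≤ Nat.card ι := by
      rw [← hn, ← Set.image_univ]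
      refine (Set.encard_image_le _ _).trans ?_
      rw [Set.encard_univ, ENat.card_eq_coe_natCard]
    exact_mod_cast this
  obtain ⟨α, hα⟩ := subsetOrbit_eq_iff.1 (hR' _ hmem)
  refine ⟨α, fun i => Set.mem_biUnion hmem ?_⟩
  rw [hα]
  exact ⟨a i, ⟨i, rfl⟩, rfl⟩

end Orbits

section Core

variable {L : FirstOrder.Language.{u, v}} {Δ Γ : Type*} [L.Structure Δ] [L.Structure Γ]

theorem tupleType_comp_endomorphism (hcore : IsCoreStructure L Γ)
    (hmc : IsModelCompleteStructure L Γ) (f : Γ →[L] Γ) {ι : Type} [Finite ι] (a : ι → Γ) :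
    tupleType L (fun i => f (a i)) = tupleType L a := by
  -- Model-completeness speaks only of variables in `Fin n`, hence the reindexing.
  obtain ⟨k, ⟨e⟩⟩ := Finite.exists_equiv_fin ι
  have key : tupleType L (a ∘ e.symm) = tupleType L ((fun i => f (a i)) ∘ e.symm) := by
    refine tupleType_eq_of_subset fun φ hφ => ?_
    obtain ⟨e', he'⟩ := hcore f
    have := hmc e' k φ _ hφ
    simp only [he'] at this
    exact this
  have := tupleType_comp key e
  simp only [Function.comp_assoc, Equiv.symm_comp_self, Function.comp_id] at this
  exact this.symm

theorem tupleType_eq_of_conjugate_image (hcore : IsCoreStructure L Γ)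
    (hmc : IsModelCompleteStructure L Γ) (g : Γ →[L] Δ) (h : Δ →[L] Γ) (α : Δ ≃[L] Δ)
    {ι : Type} [Finite ι] {a b : ι → Γ} (hab : ∀ i, α (g (a i)) = g (b i)) :
    tupleType L a = tupleType L b := by
  rw [← tupleType_comp_endomorphism hcore hmc (h.comp (α.toHom.comp g)) a,
    ← tupleType_comp_endomorphism hcore hmc (h.comp g) b]
  congr 1
  funext i
  exact congrArg h (hab i)

theorem finite_range_tupleType (hΔ : IsOmegaCategorical L Δ) (hcore : IsCoreStructure L Γ)
    (hmc : IsModelCompleteStructure L Γ) (g : Γ →[L] Δ) (h : Δ →[L] Γ)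
    (ι : Type) [Finite ι] : (Set.range (tupleType L : (ι → Γ) → _)).Finite := by
  obtain ⟨F, hF, hmeet⟩ := hΔ.exists_finite_set ι
  choose α hα using hmeet
  have := hF.to_subtype
  -- Code `a` by a conjugate of `g a` inside the finite set `F`; the code determines the type.
  let c : (ι → Γ) → ι → F := fun a i => ⟨α (fun i => g (a i)) (g (a i)), hα _ i⟩
  have hc : ∀ a b : ι → Γ, c a = c b → tupleType L a = tupleType L b := by
    intro a b hab
    refine tupleType_eq_of_conjugate_image hcore hmc g h
      ((α fun i => g (b i)).symm.comp (α fun i => g (a i))) fun i => ?_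
    have := congrArg Subtype.val (congrFun hab i)
    simp only [c] at this
    simp [this]
  have hfac : Set.range (tupleType L : (ι → Γ) → _) ⊆
      Set.range fun y : Set.range c => tupleType L y.2.choose := by
    rintro _ ⟨a, rfl⟩
    exact ⟨⟨c a, a, rfl⟩, hc _ _ (Set.mem_range_self (f := c) a).choose_spec⟩
  exact (Set.finite_range _).subset hfac

end Core

theorem mainTheorem12 {L : FirstOrder.Language.{u, v}} [L.IsRelational]
    {Δ : Type*} {Γ : Type*} [L.Structure Δ] [L.Structure Γ]
    (hΔ : IsOmegaCategorical L Δ) (hΓ : IsModelCompleteCoreOf L Γ Δ) (n : ℕ) :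
    (nSubsetOrbits L Γ n).encard ≤ (nSubsetOrbits L Δ n).encard := by
  obtain ⟨hcount, hcore, hmc, ⟨g⟩, ⟨h⟩⟩ := hΓ
  have hfin := finite_range_tupleType hΔ hcore hmc g h
  have hg : Function.Injective g := by
    obtain ⟨e, he⟩ := hcore (h.comp g)
    intro x y hxy
    refine e.injective ?_
    rw [he, he]
    exact congrArg h hxy
  have hrep : ∀ O ∈ nSubsetOrbits L Γ n,
      ∃ S : Set Γ, S.encard = (n : ℕ∞) ∧ O = subsetOrbit L Γ S := fun O hO => hO
  choose! R hR hR' using hrep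
  -- The orbit of `g '' S` may depend on the choice of `S` in its orbit, so representatives are
  -- fixed; only injectivity matters.
  refine Set.encard_le_encard_of_injOn (f := fun O => subsetOrbit L Δ (g '' R O))
    (fun O hO => ⟨_, (hg.encard_image _).trans (hR O hO), rfl⟩) fun O hO O' hO' heq => ?_
  rw [hR' O hO, hR' O' hO', subsetOrbit_eq_iff]
  obtain ⟨α, hα⟩ := subsetOrbit_eq_iff.1 heq
  obtain ⟨k, a, -, ha⟩ := (Set.finite_of_encard_eq_coe (hR O hO)).fin_param
  rw [← ha] at hα ⊢
  rw [← Set.range_comp, ← Set.range_comp] at hα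
  -- Pull `α ∘ g ∘ a` back along `g` to list `R O'` in an order matching `a`.
  have hex : ∀ i, ∃ y ∈ R O', g y = α (g (a i)) := fun i => by
    have : α (g (a i)) ∈ g '' R O' := hα ▸ ⟨i, rfl⟩
    exact this
  choose b hb hgb using hex
  have hbr : Set.range b = R O' := by
    refine hg.image_injective ?_
    rw [hα, ← Set.range_comp]
    exact congrArg Set.range (funext hgb)
  obtain ⟨β, hβ⟩ := exists_automorphism_of_tupleType_eq hfin
    (tupleType_eq_of_conjugate_image hcore hmc g h α fun i => (hgb i).symm)
  refine ⟨β, ?_⟩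
  rw [← hbr, ← Set.range_comp]
  exact congrArg Set.range (funext fun i => (hβ i).symm)
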